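/- Conventions. Let $T$ be a finite tree and $\lambda\in\mathbb R$ an eigenvalue of its adjacency matrix; eigenvectors are real and non-zero. For a finite graph $G$ and $\mu\in\mathbb R$ let $N_\mu(G)$ be the set of vertices on which every eigenvector of $G$ for $\mu$ vanishes, and let $N^C_\mu(G)$ be the set of vertices $v$ for which there is an eigenvector $x$ of $G$ for $\mu$ with $x(v)=0$ and $x(u)\neq 0$ for some neighbour $u$ of $v$ (for trees $N^C_\mu(G)\subseteq N_\mu(G)$). Let $C_1,\dots,C_s$ be the components of $T\setminus N_\lambda(T)$ and let $c_1,\dots,c_s$ be the vertices to which they are contracted in $T/\{C_i\}_{i=1}^s$. The skeleton $S_\lambda(T)$ is the subgraph of $T/\{C_i\}_{i=1}^s$ induced by $N^C_\lambda(T)\cup\{c_1,\dots,c_s\}$; its null space is the null space of its adjacency matrix, and its nullity is the dimension of that space. A set $\{x_1,\dots,x_r\}$ of eigenvectors of a graph $G$ for $\mu$ is straight if the components of $G\setminus N_\mu(G)$ can be numbered $D_1,\dots,D_m$ (with $m\ge r$) so that $x_j|_{D_j}\neq 0$ and $x_j|_{D_i}=0$ for $1\le j\le r$ and $j<i\le r$.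 Say that a vector $b$ on $V(T)$ and a vector $b'$ on $V(S_\lambda(T))$ match if $b$ vanishes on $N_\lambda(T)$, $b'$ vanishes on $N^C_\lambda(T)$, and for each $i$ either $b'(c_i)\neq0$ and $b$ has no zero entry on $C_i$, or $b'(c_i)=0$ and $b|_{C_i}=0$. Theorem. (1) For every eigenvector $b$ of $T$ for $\lambda$ there is a non-zero vector $b'$ in the null space of $S_\lambda(T)$ that matches $b$. (2) If $\{b_1,\dots,b_r\}$ is a straight set of eigenvectors of $T$ for $\lambda$ and $b'_1,\dots,b'_r$ are non-zero vectors in the null space of $S_\lambda(T)$ such that $b'_j$ matches $b_j$ for every $j$, then $b'_1,\dots,b'_r$ are linearly independent. (3) For every non-zero vector $b'$ in the null space of $S_\lambda(T)$ there is an eigenvector $b$ of $T$ for $\lambda$ that matches $b'$. (4) If $\{b'_1,\dots,b'_r\}$ is a straight set of eigenvectors of $S_\lambda(T)$ for the eigenvalue $0$ and $b_1,\dots,b_r$ are eigenvectors of $T$ for $\lambda$ such that $b_j$ matches $b'_j$ for every $j$, then $b_1,\dots,b_r$ are linearly independent. (5) The multiplicity of $\lambda$ as an eigenvalue of $T$ equals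 the nullity of $S_\lambda(T)$. -/

import Mathlib

namespace TreeSkeleton

/-- The adjacency matrix of a finite graph, acting on real vectors indexed by its vertices. -/
noncomputable def adjOp {V : Type*} [Finite V] (G : SimpleGraph V) : Module.End ℝ (V → ℝ) :=
  letI : Fintype V := Fintype.ofFinite V
  letI : DecidableEq V := Classical.decEq V
  letI : DecidableRel G.Adj := Classical.decRel G.Adj
  Matrix.toLin' (G.adjMatrix ℝ)

/-- `x` is an eigenvector (in particular non-zero) of the graph `G` for the eigenvalue `lam`. -/
def IsEigvec {V : Type*} [Finite V] (G : SimpleGraph V) (lam : ℝ) (x : V → ℝ) : Prop :=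
  (adjOp G).HasEigenvector lam x

/-- `N_lam(G)`: the vertices on which every eigenvector for `lam` vanishes. -/
def zeroSet {V : Type*} [Finite V] (G : SimpleGraph V) (lam : ℝ) : Set V :=
  {v | ∀ x : V → ℝ, IsEigvec G lam x → x v = 0}

/-- `N^C(G, x)`: the vertices on which `x` vanishes and that are adjacent to a vertex on which
`x` does not vanish, i.e. to one of the components of the graph `G` minus the zeros of `x`. -/
def zeroBdryOf {V : Type*} (G : SimpleGraph V) (x : V → ℝ) : Set V :=
  {v | x v = 0 ∧ ∃ u, G.Adj v u ∧ x u ≠ 0}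

/-- `N^C_lam(G)`: the union of the sets `N^C(G, x)` over all eigenvectors `x` for `lam`. -/
def zeroBdry {V : Type*} [Finite V] (G : SimpleGraph V) (lam : ℝ) : Set V :=
  {v | ∃ x : V → ℝ, IsEigvec G lam x ∧ v ∈ zeroBdryOf G x}

/-- The components of `G` minus the vertex set `N`. -/
abbrev Comp {V : Type*} (G : SimpleGraph V) (N : Set V) : Type _ :=
  (G.induce Nᶜ).ConnectedComponent

/-- The set of vertices of `G` that lie in the component `C` of `G` minus `N`. -/
def Comp.verts {V : Type*} {G : SimpleGraph V} {N : Set V} (C : Comp G N) : Set V :=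
  Subtype.val '' C.supp

open Classical in
/-- The vertex of the contracted graph to which a vertex of `G` belongs: a vertex of `N` stays
itself, any other vertex goes to the contracted vertex of its component. -/
noncomputable def contractMap {V : Type*} (G : SimpleGraph V) (N : Set V) (v : V) :
    ↥N ⊕ Comp G N :=
  if h : v ∈ N then Sum.inl ⟨v, h⟩ else Sum.inr ((G.induce Nᶜ).connectedComponentMk ⟨v, h⟩)

/-- The graph obtained from `G` by contracting every component of `G` minus `N` to one vertex;
two distinct vertices are adjacent if some edge of `G` joins the corresponding parts. -/
noncomputable def contraction {V : Type*} (G : SimpleGraph V) (N : Set V) :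
    SimpleGraph (↥N ⊕ Comp G N) :=
  G.map (contractMap G N)

/-- The vertices of the contraction by the components of `G` minus `N_lam(G)` that belong to the
skeleton: those of `N^C_lam(G)` and all contracted vertices. -/
def skeletonVerts {V : Type*} [Finite V] (G : SimpleGraph V) (lam : ℝ) :
    Set (↥(zeroSet G lam) ⊕ Comp G (zeroSet G lam)) :=
  {a | (∃ w, w.1 ∈ zeroBdry G lam ∧ a = Sum.inl w) ∨ ∃ C, a = Sum.inr C}

/-- The skeleton `S_lam(G)`. -/
noncomputable def skeleton {V : Type*} [Finite V] (G : SimpleGraph V) (lam : ℝ) :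
    SimpleGraph ↥(skeletonVerts G lam) :=
  (contraction G (zeroSet G lam)).induce (skeletonVerts G lam)

/-- The skeleton vertex obtained by contracting the component `C`. -/
def compVertex {V : Type*} [Finite V] {G : SimpleGraph V} {lam : ℝ}
    (C : Comp G (zeroSet G lam)) : ↥(skeletonVerts G lam) :=
  ⟨Sum.inr C, Or.inr ⟨C, rfl⟩⟩

instance {V : Type*} [Finite V] (G : SimpleGraph V) (N : Set V) : Finite (Comp G N) :=
  Quot.finite _

/-- `x` and `y` have matching zero/non-zero patterns: `x` is non-zero everywhere on a component `C`
of `G` minus `N_lam(G)` if `y` is non-zero on the contracted vertex of `C`, and `x` is zero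
everywhere on `C` otherwise; `x` vanishes on `N_lam(G)` and `y` on all skeleton vertices that are
not contracted components. -/
def SamePattern {V : Type*} [Finite V] (G : SimpleGraph V) (lam : ℝ)
    (x : V → ℝ) (y : ↥(skeletonVerts G lam) → ℝ) : Prop :=
  (∀ C : Comp G (zeroSet G lam), ∀ v ∈ C.verts, x v ≠ 0 ↔ y (compVertex C) ≠ 0) ∧
  (∀ v ∈ zeroSet G lam, x v = 0) ∧
  (∀ a : ↥(skeletonVerts G lam), (∀ C, a ≠ compVertex C) → y a = 0)

/-- The eigenvectors `x 0, ..., x (r - 1)` of `G` for `lam` form a straight set: there are distinct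
components `C 0, ..., C (r - 1)` of `G` minus `N_lam(G)` (the first `r` in a numbering of all
components) such that `x j` does not vanish identically on `C j` but does so on `C i` for
`j < i`. -/
def IsStraight {V : Type*} [Finite V] (G : SimpleGraph V) (lam : ℝ) {r : ℕ}
    (x : Fin r → V → ℝ) : Prop :=
  (∀ j, IsEigvec G lam (x j)) ∧
  ∃ C : Fin r ↪ Comp G (zeroSet G lam),
    ∀ j, (∃ v ∈ (C j).verts, x j v ≠ 0) ∧ ∀ i, j < i → ∀ v ∈ (C i).verts, x j v = 0

/-- The multiplicity of the eigenvalue `lam` of `G`, i.e. the dimension of its eigenspace. -/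
noncomputable def multiplicity {V : Type*} [Finite V] (G : SimpleGraph V) (lam : ℝ) : ℕ :=
  Module.finrank ℝ ((adjOp G).eigenspace lam)

/-- The nullity of `G`, i.e. the dimension of the null space of its adjacency matrix. -/
noncomputable def nullity {V : Type*} [Finite V] (G : SimpleGraph V) : ℕ :=
  Module.finrank ℝ (LinearMap.ker (adjOp G))

end TreeSkeleton

/-! For `x`, `y` in the same eigenspace, `x a * y b - y a * x b` on the edges `ab` is a circulation:
at each vertex both terms of its divergence equal the eigenvalue times `x a * y a`. A forest carries
no non-zero circulation, since every edge is the only edge of some cut (`circulation_eq_zero`). So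
`x` and `y` are proportional along every edge (`mul_eq_mul_of_mem_eigenspace`). Fix `z` in the
eigenspace, non-zero at every vertex off the zero set. On each component every eigenvector is then a
multiple of `z`. Acyclicity gives a nowhere zero `θ` with `θ * z` constant on components and `θ`
constant across edges leaving the zero set (`exists_isScaling`). Multiplying by `θ` makes
eigenvectors constant on components and turns their equations at boundary vertices into the null
equations of the skeleton, because a vertex has at most one neighbour in each component. Dividing by
`θ` goes back. Null vectors vanish at boundary vertices by the same proportionality, applied in the
skeleton, which is again a forest. Both maps preserve zero patterns, so they are injective and the
dimensions agree; straight sets give triangular, hence independent, families. -/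

namespace TreeSkeleton

open SimpleGraph

/-! ### Forests: cuts, circulations, potentials and contractions -/

section Acyclic

variable {V : Type*} {G : SimpleGraph V}

/-- An edge of an acyclic graph is the only edge leaving some vertex set. -/
theorem exists_cut_of_isAcyclic (hG : G.IsAcyclic) {u v : V} (huv : G.Adj u v) :
    ∃ S : Set V, u ∈ S ∧ v ∉ S ∧ ∀ a b, a ∈ S → b ∉ S → G.Adj a b → a = u ∧ b = v := by
  have hb := isBridge_iff.1 (isAcyclic_iff_forall_adj_isBridge.1 hG huv)
  refine ⟨{a | (G.deleteEdges {s(u, v)}).Reachable u a}, Reachable.refl _, hb, ?_⟩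
  intro a b ha hbS hab
  by_contra hne
  have hadj : (G.deleteEdges {s(u, v)}).Adj a b := by
    rw [deleteEdges_adj]
    refine ⟨hab, fun h => ?_⟩
    rcases Sym2.eq_iff.1 (Set.mem_singleton_iff.1 h) with h | h
    · exact hne h
    · exact hbS (h.2 ▸ Reachable.refl _)
  exact hbS (Reachable.trans ha hadj.reachable)

/-- Once the edge `uv` is deleted, no walk from `u` can leave `S`, so every edge is a bridge. -/
theorem isAcyclic_of_cut
    (h : ∀ u v, G.Adj u v →
      ∃ S : Set V, u ∈ S ∧ v ∉ S ∧ ∀ a b, a ∈ S → b ∉ S → G.Adj a b → a = u ∧ b = v) :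
    G.IsAcyclic := by
  rw [isAcyclic_iff_forall_adj_isBridge]
  intro u v huv
  obtain ⟨S, hu, hv, hS⟩ := h u v huv
  rw [isBridge_iff]
  intro hr
  have key : ∀ a, (G.deleteEdges {s(u, v)}).Reachable u a → a ∈ S := by
    intro a ha
    rw [reachable_iff_reflTransGen] at ha
    induction ha with
    | refl => exact hu
    | @tail b c _ hbc ih =>
      by_contra hc
      rw [deleteEdges_adj] at hbc
      obtain ⟨rfl, rfl⟩ := hS b c ih hc hbc.1
      exact hbc.2 rfl
  exact hv (key v hr)

/-- Every circulation on a finite acyclic graph is zero. -/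
theorem circulation_eq_zero [Fintype V] (hG : G.IsAcyclic) (g : V → V → ℝ)
    (hanti : ∀ a b, g a b = -g b a) (hsupp : ∀ a b, ¬ G.Adj a b → g a b = 0)
    (hdiv : ∀ a, ∑ b, g a b = 0) (u v : V) : g u v = 0 := by
  classical
  by_cases huv : G.Adj u v
  swap
  · exact hsupp u v huv
  obtain ⟨S, hu, hv, hS⟩ := exists_cut_of_isAcyclic hG huv
  -- Sum the divergence over the cut side `S`: inner edges cancel by antisymmetry, and only `uv`
  -- leaves `S`.
  have h0 : ∑ a with a ∈ S, ∑ b, g a b = 0 := Finset.sum_eq_zero fun a _ => hdiv a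
  have hsplit : ∀ a, ∑ b, g a b = ∑ b with b ∈ S, g a b + ∑ b with b ∉ S, g a b := fun a =>
    (Finset.sum_filter_add_sum_filter_not _ _ _).symm
  have hin : ∑ a with a ∈ S, ∑ b with b ∈ S, g a b = 0 := by
    have h1 : ∑ a with a ∈ S, ∑ b with b ∈ S, g a b
        = -∑ a with a ∈ S, ∑ b with b ∈ S, g a b := by
      conv_lhs => rw [Finset.sum_comm]
      simp only [← Finset.sum_neg_distrib]
      exact Finset.sum_congr rfl fun a _ => Finset.sum_congr rfl fun b _ => hanti b a
    linarith
  have hout : ∑ a with a ∈ S, ∑ b with b ∉ S, g a b = g u v := by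
    rw [Finset.sum_eq_single_of_mem u (by simpa using hu), Finset.sum_eq_single_of_mem v
      (by simpa using hv)]
    · intro b hb hne
      refine hsupp u b fun h => hne (hS u b hu (by simpa using hb) h).2
    · intro a ha hne
      refine Finset.sum_eq_zero fun b hb => hsupp a b fun h => hne ?_
      exact (hS a b (by simpa using ha) (by simpa using hb) h).1
  simp only [hsplit, Finset.sum_add_distrib, hin, hout, zero_add] at h0
  exact h0

/-- Multiplicative edge weights on a finite acyclic graph come from a vertex potential. -/
theorem exists_potential [Finite V] (hG : G.IsAcyclic) (ρ : V → V → ℝ)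
    (hne : ∀ a b, ρ a b ≠ 0) (hinv : ∀ a b, ρ a b * ρ b a = 1) :
    ∃ θ : V → ℝ, (∀ a, θ a ≠ 0) ∧ ∀ a b, G.Adj a b → θ b = ρ a b * θ a := by
  classical
  induction G using WellFoundedLT.induction with
  | ind G ih =>
  by_cases hbot : ∃ u v, G.Adj u v
  swap
  · push Not at hbot
    exact ⟨fun _ => 1, by simp, fun a b h => (hbot a b h).elim⟩
  obtain ⟨u, v, huv⟩ := hbot
  have hlt : G.deleteEdges {s(u, v)} < G := by
    refine lt_of_le_of_ne (deleteEdges_le _) fun h => ?_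
    rw [← h, deleteEdges_adj] at huv
    exact huv.2 rfl
  obtain ⟨θ, hθ, hθe⟩ := ih _ hlt (hG.anti hlt.le)
  obtain ⟨S, hu, hv, hS⟩ := exists_cut_of_isAcyclic hG huv
  have hc : ρ v u * θ v / θ u ≠ 0 := div_ne_zero (mul_ne_zero (hne _ _) (hθ _)) (hθ _)
  -- Rescaling one side of the cut disturbs no edge but `uv`; the factor makes the new value at `u`
  -- equal to `ρ v u * θ v`, as that edge demands.
  refine ⟨fun a => if a ∈ S then ρ v u * θ v / θ u * θ a else θ a, fun a => ?_, fun a b hab => ?_⟩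
  · dsimp only
    split_ifs
    · exact mul_ne_zero hc (hθ a)
    · exact hθ a
  have hdel : ¬ (a = u ∧ b = v) → ¬ (a = v ∧ b = u) → θ b = ρ a b * θ a := by
    intro h1 h2
    refine hθe a b ?_
    rw [deleteEdges_adj]
    refine ⟨hab, fun h => ?_⟩
    rcases Sym2.eq_iff.1 (Set.mem_singleton_iff.1 h) with h | h
    exacts [h1 h, h2 h]
  by_cases ha : a ∈ S <;> by_cases hb : b ∈ S
  · simp only [ha, hb, if_true]
    rw [hdel (fun h => hv (h.2 ▸ hb)) (fun h => hv (h.1 ▸ ha))]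
    ring
  · obtain ⟨rfl, rfl⟩ := hS a b ha hb hab
    simp only [ha, hb, if_true, if_false]
    rw [div_mul_cancel₀ _ (hθ _), ← mul_assoc, hinv, one_mul]
  · obtain ⟨rfl, rfl⟩ := hS b a hb ha hab.symm
    simp only [ha, hb, if_true, if_false]
    rw [div_mul_cancel₀ _ (hθ _)]
  · simp only [ha, hb, if_false]
    exact hdel (fun h => ha (h.1 ▸ hu)) (fun h => hb (h.2 ▸ hu))

/-- The push-forward of an acyclic graph along a map with connected fibres is acyclic. -/
theorem isAcyclic_map {W : Type*} (hG : G.IsAcyclic) (f : V → W)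
    (hf : ∀ (S : Set V), (∀ a b, G.Adj a b → f a = f b → a ∈ S → b ∈ S) →
      ∀ p q, f p = f q → p ∈ S → q ∈ S) :
    (G.map f).IsAcyclic := by
  refine isAcyclic_of_cut fun x y hxy => ?_
  obtain ⟨hne, u, v, huv, rfl, rfl⟩ := (map_adj' ..).1 hxy
  obtain ⟨S, hu, hv, hS⟩ := exists_cut_of_isAcyclic hG huv
  -- The only edge leaving `S` joins different fibres, so `S` is a union of fibres and its image is
  -- again a cut.
  have hsat : ∀ p q, f p = f q → p ∈ S → q ∈ S := by
    refine hf S fun a b hab hfab ha => ?_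
    by_contra hb
    obtain ⟨rfl, rfl⟩ := hS a b ha hb hab
    exact hne hfab
  refine ⟨f '' S, ⟨u, hu, rfl⟩, fun ⟨p, hp, hpv⟩ => hv (hsat _ _ hpv hp), ?_⟩
  rintro _ c ⟨p, hp, rfl⟩ hc hadj
  obtain ⟨-, a, b, hab, hfa, rfl⟩ := (map_adj' ..).1 hadj
  have ha : a ∈ S := hsat _ _ hfa.symm hp
  obtain ⟨rfl, rfl⟩ := hS a b ha (fun hb => hc ⟨b, hb, rfl⟩) hab
  exact ⟨hfa.symm, rfl⟩

/-- In an acyclic graph, a vertex outside a connected fibre has at most one neighbour in it. -/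
theorem eq_of_adj_of_fibre_eq {W : Type*} (hG : G.IsAcyclic) (f : V → W)
    (hf : ∀ (S : Set V), (∀ a b, G.Adj a b → f a = f b → a ∈ S → b ∈ S) →
      ∀ p q, f p = f q → p ∈ S → q ∈ S)
    {u u' v : V} (huv : G.Adj u v) (huv' : G.Adj u' v) (huu' : f u = f u') (hne : f u ≠ f v) :
    u = u' := by
  obtain ⟨S, hu, hv, hS⟩ := exists_cut_of_isAcyclic hG huv
  have hu' : u' ∈ S := by
    refine hf S (fun a b hab hfab ha => ?_) u u' huu' hu
    by_contra hb
    obtain ⟨rfl, rfl⟩ := hS a b ha hb hab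
    exact hne hfab
  exact (hS u' v hu' hv huv').1.symm

end Acyclic

/-! ### Eigenspaces on forests and generic eigenvectors -/

section Eigen

variable {V : Type*}

open Classical in
theorem adjOp_apply [Fintype V] (G : SimpleGraph V) (x : V → ℝ) (v : V) :
    adjOp G x v = ∑ u, if G.Adj v u then x u else 0 := by
  simp only [adjOp, Matrix.toLin'_apply, Matrix.mulVec, dotProduct, adjMatrix_apply, ite_mul,
    one_mul, zero_mul]
  congr!

variable [Finite V] {G : SimpleGraph V} {lam : ℝ}

/-- On an acyclic graph two vectors of the same eigenspace are proportional along every edge. -/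
theorem mul_eq_mul_of_mem_eigenspace (hG : G.IsAcyclic) {x y : V → ℝ}
    (hx : x ∈ (adjOp G).eigenspace lam) (hy : y ∈ (adjOp G).eigenspace lam) {u v : V}
    (huv : G.Adj u v) : x u * y v = y u * x v := by
  classical
  have := Fintype.ofFinite V
  rw [Module.End.mem_eigenspace_iff] at hx hy
  have h := circulation_eq_zero hG (fun a b => if G.Adj a b then x a * y b - y a * x b else 0)
    (fun a b => by
      by_cases hab : G.Adj a b
      · simp only [hab, hab.symm, if_true]; ring
      · simp [hab, G.adj_comm b a])
    (fun a b hab => if_neg hab)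
    (fun a => by
      have h1 := congrFun hx a
      have h2 := congrFun hy a
      rw [adjOp_apply] at h1 h2
      have : ∀ b, (if G.Adj a b then x a * y b - y a * x b else 0)
          = x a * (if G.Adj a b then y b else 0) - y a * (if G.Adj a b then x b else 0) := by
        intro b; split_ifs <;> ring
      simp only [this, Finset.sum_sub_distrib, ← Finset.mul_sum, h1, h2, Pi.smul_apply,
        smul_eq_mul]
      ring) u v
  rw [if_pos huv] at h
  linarith

theorem eq_zero_of_mem_zeroSet {x : V → ℝ} (hx : x ∈ (adjOp G).eigenspace lam) {v : V}
    (hv : v ∈ zeroSet G lam) : x v = 0 := by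
  by_cases h0 : x = 0
  · simp [h0]
  · exact hv x ⟨hx, h0⟩

/-- Some vector of the eigenspace is non-zero at every vertex outside the zero set. -/
theorem exists_generic_mem_eigenspace (G : SimpleGraph V) (lam : ℝ) :
    ∃ z ∈ (adjOp G).eigenspace lam, ∀ v ∉ zeroSet G lam, z v ≠ 0 := by
  let E := (adjOp G).eigenspace lam
  let p : ↥(zeroSet G lam)ᶜ → Subspace ℝ E := fun v =>
    LinearMap.ker ((LinearMap.proj (v : V) : (V → ℝ) →ₗ[ℝ] ℝ).comp E.subtype)
  -- A real vector space is not a finite union of proper subspaces, and each `p v` is proper because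
  -- `v` is off the zero set.
  have h : ⋃ i, (p i : Set E) ≠ Set.univ := by
    intro hU
    obtain ⟨⟨v, hv⟩, hvp⟩ := Subspace.exists_eq_top_of_iUnion_eq_univ hU
    refine hv fun x hx => ?_
    have : (⟨x, hx.1⟩ : E) ∈ p ⟨v, hv⟩ := hvp ▸ Submodule.mem_top
    simpa [p] using this
  obtain ⟨z, hz⟩ := (Set.ne_univ_iff_exists_notMem _).1 h
  refine ⟨z.1, z.2, fun v hv h0 => hz ?_⟩
  exact Set.mem_iUnion.2 ⟨⟨v, hv⟩, by simpa [p] using h0⟩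

theorem mem_zeroBdry_of_adj {v u : V} (hv : v ∈ zeroSet G lam) (hu : u ∉ zeroSet G lam)
    (hvu : G.Adj v u) : v ∈ zeroBdry G lam := by
  simp only [zeroSet, Set.mem_ofPred_eq, not_forall] at hu
  obtain ⟨x, hx, hxu⟩ := hu
  exact ⟨x, hx, hv x hx, u, hvu, hxu⟩

/-- A boundary vertex of the zero set has a neighbour outside the zero set. -/
theorem exists_adj_notMem_zeroSet {v : V} (hv : v ∈ zeroBdry G lam) :
    ∃ u ∉ zeroSet G lam, G.Adj v u := by
  obtain ⟨x, hx, -, u, hvu, hxu⟩ := hv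
  exact ⟨u, fun h => hxu (h x hx), hvu⟩

/-- A triangular family of vectors is linearly independent. -/
theorem linearIndependent_of_triangular {r : ℕ} {W : Type*} (x : Fin r → W → ℝ) (w : Fin r → W)
    (hd : ∀ j, x j (w j) ≠ 0) (ht : ∀ j i, j < i → x j (w i) = 0) : LinearIndependent ℝ x := by
  rw [Fintype.linearIndependent_iff]
  intro g hg i
  -- Downward induction: at `w i` the terms below `i` vanish by `ht`, those above `i` because their
  -- coefficients are already zero.
  induction i using WellFoundedGT.induction with
  | ind i ih =>
  have h := congrFun hg (w i)
  simp only [Finset.sum_apply, Pi.smul_apply, smul_eq_mul, Pi.zero_apply] at h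
  rw [Finset.sum_eq_single_of_mem i (Finset.mem_univ i)] at h
  · exact (mul_eq_zero.1 h).resolve_right (hd i)
  · intro j _ hj
    rcases lt_or_gt_of_ne hj with hlt | hgt
    · rw [ht j i hlt, mul_zero]
    · rw [ih j hgt, zero_mul]

end Eigen

/-! ### Fibres of the contraction -/

section Contract

variable {V : Type*} {G : SimpleGraph V} {N : Set V}

theorem contractMap_of_mem {v : V} (h : v ∈ N) : contractMap G N v = Sum.inl ⟨v, h⟩ := dif_pos h

theorem contractMap_of_notMem {v : V} (h : v ∉ N) :
    contractMap G N v = Sum.inr ((G.induce Nᶜ).connectedComponentMk ⟨v, h⟩) := dif_neg h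

theorem contractMap_eq_of_adj {a b : V} (hab : G.Adj a b) (ha : a ∉ N) (hb : b ∉ N) :
    contractMap G N a = contractMap G N b := by
  rw [contractMap_of_notMem ha, contractMap_of_notMem hb]
  congr 1
  exact ConnectedComponent.sound (Adj.reachable (by simpa using hab))

/-- The fibres of the contraction map are connected. -/
theorem mem_of_contractMap_eq (S : Set V)
    (hS : ∀ a b, G.Adj a b → contractMap G N a = contractMap G N b → a ∈ S → b ∈ S) (p q : V)
    (h : contractMap G N p = contractMap G N q) (hp : p ∈ S) : q ∈ S := by
  by_cases hpN : p ∈ N <;> by_cases hqN : q ∈ N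
  · rw [contractMap_of_mem hpN, contractMap_of_mem hqN, Sum.inl.injEq, Subtype.mk.injEq] at h
    exact h ▸ hp
  · simp [contractMap_of_mem hpN, contractMap_of_notMem hqN] at h
  · simp [contractMap_of_mem hqN, contractMap_of_notMem hpN] at h
  · rw [contractMap_of_notMem hpN, contractMap_of_notMem hqN, Sum.inr.injEq] at h
    have hr := ConnectedComponent.exact h
    rw [reachable_iff_reflTransGen] at hr
    have key : ∀ c : ↥Nᶜ, Relation.ReflTransGen (G.induce Nᶜ).Adj ⟨p, hpN⟩ c → c.1 ∈ S := by
      intro c hc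
      induction hc with
      | refl => exact hp
      | @tail b c _ hbc ih =>
        have hbc' : G.Adj b c := by simpa using hbc
        exact hS b c hbc' (contractMap_eq_of_adj hbc' b.2 c.2) ih
    exact key _ hr

theorem mem_verts_iff {C : Comp G N} {v : V} :
    v ∈ C.verts ↔ ∃ h : v ∉ N, (G.induce Nᶜ).connectedComponentMk ⟨v, h⟩ = C := by
  constructor
  · rintro ⟨⟨w, hw⟩, hC, rfl⟩
    exact ⟨hw, hC⟩
  · rintro ⟨h, hC⟩
    exact ⟨⟨v, h⟩, hC, rfl⟩

end Contract

/-! ### The skeleton and the scaling -/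

section Skeleton

variable {V : Type*} [Finite V] {T : SimpleGraph V} {lam : ℝ}

/-- A vector on `V` whose entries are multiplied by `θ` and read off at a representative of every
component, as a vector on the skeleton that vanishes at all other vertices. -/
noncomputable def toSkeleton (T : SimpleGraph V) (lam : ℝ) (θ : V → ℝ) :
    (V → ℝ) →ₗ[ℝ] (↥(skeletonVerts T lam) → ℝ) where
  toFun b a := Sum.elim (fun _ => 0) (fun C => θ (Quot.out C).1 * b (Quot.out C).1) a.1
  map_add' b c := by
    ext ⟨a | a, ha⟩ <;> simp [mul_add]
  map_smul' t b := by
    ext ⟨a | a, ha⟩ <;> simp [mul_left_comm]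

open Classical in
/-- A vector on the skeleton, spread over the components of the tree minus its zero set and
divided by `θ`; it vanishes on the zero set. -/
noncomputable def ofSkeleton (T : SimpleGraph V) (lam : ℝ) (θ : V → ℝ) :
    (↥(skeletonVerts T lam) → ℝ) →ₗ[ℝ] (V → ℝ) where
  toFun y v := if h : v ∈ zeroSet T lam then 0 else
    y (compVertex ((T.induce (zeroSet T lam)ᶜ).connectedComponentMk ⟨v, h⟩)) / θ v
  map_add' y y' := by
    ext v
    by_cases h : v ∈ zeroSet T lam <;> simp [h, add_div]
  map_smul' t y := by
    ext v
    by_cases h : v ∈ zeroSet T lam <;> simp [h, mul_div_assoc]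

/-- `θ` is nowhere zero, is constant along edges that leave the zero set, and is inversely
proportional to `z` on every component. -/
structure IsScaling (T : SimpleGraph V) (lam : ℝ) (z θ : V → ℝ) : Prop where
  ne_zero : ∀ v, θ v ≠ 0
  eq_of_adj : ∀ v u, v ∈ zeroSet T lam → u ∉ zeroSet T lam → T.Adj v u → θ u = θ v
  mul_eq_of_adj : ∀ v u, v ∉ zeroSet T lam → u ∉ zeroSet T lam → T.Adj v u →
    θ u * z u = θ v * z v

/-- Both conditions prescribe ratios of `θ` along edges: `z a / z b` inside components, `1`
elsewhere. On a forest such ratios integrate to a potential. -/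
theorem exists_isScaling (hT : T.IsAcyclic) {z : V → ℝ} (hz : ∀ v ∉ zeroSet T lam, z v ≠ 0) :
    ∃ θ, IsScaling T lam z θ := by
  classical
  let m : V → V → ℝ := fun a b =>
    if a ∉ zeroSet T lam ∧ b ∉ zeroSet T lam then z a / z b else 1
  have hm : ∀ a b, m a b ≠ 0 := by
    intro a b
    by_cases h : a ∉ zeroSet T lam ∧ b ∉ zeroSet T lam
    · simpa only [m, if_pos h] using div_ne_zero (hz a h.1) (hz b h.2)
    · simp only [m, if_neg h, ne_eq, one_ne_zero, not_false_eq_true]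
  have hinv : ∀ a b, m a b * m b a = 1 := by
    intro a b
    by_cases h : a ∉ zeroSet T lam ∧ b ∉ zeroSet T lam
    · simp only [m, if_pos h, if_pos h.symm]
      have := hz a h.1
      have := hz b h.2
      field_simp
    · simp only [m, if_neg h, if_neg fun h' => h (And.symm h'), one_mul]
  obtain ⟨θ, hθ, he⟩ := exists_potential hT m hm hinv
  refine ⟨θ, hθ, fun v u hv hu hvu => ?_, fun v u hv hu hvu => ?_⟩
  · rw [he v u hvu, show m v u = 1 from if_neg fun h => h.1 hv, one_mul]
  · rw [he v u hvu, show m v u = z v / z u from if_pos ⟨hv, hu⟩]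
    have := hz u hu
    field_simp

/-- This lets the proportionality argument be applied to null vectors of the skeleton itself. -/
theorem skeleton_isAcyclic (hT : T.IsAcyclic) : (skeleton T lam).IsAcyclic :=
  (isAcyclic_map hT _ mem_of_contractMap_eq).induce _

theorem skeleton_adj_iff {a b : ↥(skeletonVerts T lam)} : (skeleton T lam).Adj a b ↔
    a.1 ≠ b.1 ∧ ∃ u v, T.Adj u v ∧ contractMap T (zeroSet T lam) u = a.1 ∧
      contractMap T (zeroSet T lam) v = b.1 := by
  rw [skeleton, induce_adj, contraction, map_adj']

/-- Two contracted components are not adjacent. -/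
theorem not_skeleton_adj_compVertex (C D : Comp T (zeroSet T lam)) :
    ¬ (skeleton T lam).Adj (compVertex C) (compVertex D) := by
  rw [skeleton_adj_iff]
  rintro ⟨hne, u, v, huv, hu, hv⟩
  by_cases hu' : u ∈ zeroSet T lam
  · simp [contractMap_of_mem hu', compVertex] at hu
  by_cases hv' : v ∈ zeroSet T lam
  · simp [contractMap_of_mem hv', compVertex] at hv
  exact hne (by rw [← hu, ← hv, contractMap_eq_of_adj huv hu' hv'])

/-- A boundary vertex of the zero set, as a vertex of the skeleton. -/
def bdryVertex {v : V} (hv : v ∈ zeroSet T lam) (hv' : v ∈ zeroBdry T lam) :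
    ↥(skeletonVerts T lam) :=
  ⟨Sum.inl ⟨v, hv⟩, Or.inl ⟨⟨v, hv⟩, hv', rfl⟩⟩

theorem skeletonVerts_cases (a : ↥(skeletonVerts T lam)) :
    (∃ v, ∃ (hv : v ∈ zeroSet T lam) (hv' : v ∈ zeroBdry T lam), a = bdryVertex hv hv') ∨
      ∃ C, a = compVertex C := by
  obtain ⟨a, ⟨w, hw, rfl⟩ | ⟨C, rfl⟩⟩ := a
  · exact Or.inl ⟨w.1, w.2, hw, rfl⟩
  · exact Or.inr ⟨C, rfl⟩

theorem skeleton_adj_bdryVertex_compVertex {v : V} (hv : v ∈ zeroSet T lam)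
    (hv' : v ∈ zeroBdry T lam) (C : Comp T (zeroSet T lam)) :
    (skeleton T lam).Adj (bdryVertex hv hv') (compVertex C) ↔ ∃ u ∈ C.verts, T.Adj v u := by
  rw [skeleton_adj_iff]
  constructor
  · rintro ⟨-, p, u, hpu, hp, hu⟩
    by_cases hpN : p ∈ zeroSet T lam
    swap
    · simp [contractMap_of_notMem hpN, bdryVertex] at hp
    by_cases huN : u ∈ zeroSet T lam
    · simp [contractMap_of_mem huN, compVertex] at hu
    rw [contractMap_of_mem hpN] at hp
    rw [contractMap_of_notMem huN] at hu
    obtain rfl : p = v := by simpa [bdryVertex] using hp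
    exact ⟨u, mem_verts_iff.2 ⟨huN, by simpa [compVertex] using hu⟩, hpu⟩
  · rintro ⟨u, hu, hvu⟩
    obtain ⟨huN, rfl⟩ := mem_verts_iff.1 hu
    exact ⟨by simp [bdryVertex, compVertex], v, u, hvu, contractMap_of_mem hv,
      contractMap_of_notMem huN⟩

open Classical in
/-- For a skeleton vector that vanishes on the boundary vertices, the sum over the neighbours of a
boundary vertex in the skeleton is the sum over its neighbours in the tree. -/
theorem adjOp_skeleton_bdryVertex [Fintype V] (hT : T.IsAcyclic) (y : ↥(skeletonVerts T lam) → ℝ)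
    (hy : ∀ a, (∀ C, a ≠ compVertex C) → y a = 0) {v : V} (hv : v ∈ zeroSet T lam)
    (hv' : v ∈ zeroBdry T lam) :
    adjOp (skeleton T lam) y (bdryVertex hv hv') =
      ∑ u, if T.Adj v u then ofSkeleton T lam (fun _ => 1) y u else 0 := by
  have := Fintype.ofFinite ↥(skeletonVerts T lam)
  rw [adjOp_apply]
  have hval : ∀ u (h : u ∉ zeroSet T lam), ofSkeleton T lam (fun _ => 1) y u =
      y (compVertex ((T.induce (zeroSet T lam)ᶜ).connectedComponentMk ⟨u, h⟩)) := fun u h => by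
    simp [ofSkeleton, h]
  have hoff : ∀ u, (if T.Adj v u then ofSkeleton T lam (fun _ => 1) y u else 0) ≠ 0 →
      T.Adj v u ∧ u ∉ zeroSet T lam := by
    intro u hu
    refine ⟨by_contra fun h => hu (if_neg h), fun h => hu ?_⟩
    simp [ofSkeleton, h]
  symm
  -- Neighbours of `v` off the zero set are matched with their components; injectivity holds because
  -- two neighbours in one component would close a cycle.
  refine Finset.sum_bij_ne_zero (fun u _ hu =>
    compVertex ((T.induce (zeroSet T lam)ᶜ).connectedComponentMk ⟨u, (hoff u hu).2⟩))
    (fun _ _ _ => Finset.mem_univ _) ?_ ?_ ?_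
  · intro u _ hu u' _ hu' h
    obtain ⟨hvu, huN⟩ := hoff u hu
    obtain ⟨hvu', huN'⟩ := hoff u' hu'
    refine eq_of_adj_of_fibre_eq hT (contractMap T (zeroSet T lam)) mem_of_contractMap_eq
      hvu.symm hvu'.symm ?_ ?_
    · rw [contractMap_of_notMem huN, contractMap_of_notMem huN']
      exact congrArg Subtype.val h
    · simp [contractMap_of_notMem huN, contractMap_of_mem hv]
  · intro a _ ha
    have hadj : (skeleton T lam).Adj (bdryVertex hv hv') a := by_contra fun h => ha (if_neg h)
    rw [if_pos hadj] at ha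
    obtain ⟨C, rfl⟩ : ∃ C, a = compVertex C := by
      by_contra h
      push Not at h
      exact ha (hy a h)
    obtain ⟨u, hu, hvu⟩ := (skeleton_adj_bdryVertex_compVertex hv hv' C).1 hadj
    obtain ⟨huN, rfl⟩ := mem_verts_iff.1 hu
    exact ⟨u, Finset.mem_univ _, by rwa [if_pos hvu, hval u huN], rfl⟩
  · intro u _ hu
    obtain ⟨hvu, huN⟩ := hoff u hu
    rw [if_pos hvu, hval u huN, if_pos]
    exact (skeleton_adj_bdryVertex_compVertex hv hv' _).2 ⟨u, mem_verts_iff.2 ⟨huN, rfl⟩, hvu⟩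

/-! ### Transfer between eigenvectors and null vectors -/

variable {z θ : V → ℝ}

/-- A function that is constant along the edges of every component is constant on components. -/
theorem eq_of_mem_verts (f : V → ℝ)
    (hf : ∀ a b, a ∉ zeroSet T lam → b ∉ zeroSet T lam → T.Adj a b → f a = f b)
    {C : Comp T (zeroSet T lam)} {u v : V} (hu : u ∈ C.verts) (hv : v ∈ C.verts) : f u = f v := by
  obtain ⟨huN, rfl⟩ := mem_verts_iff.1 hu
  obtain ⟨hvN, h⟩ := mem_verts_iff.1 hv
  refine (mem_of_contractMap_eq (N := zeroSet T lam) (G := T) {p | f u = f p} ?_ u v ?_ rfl)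
  · intro a b hab hfab ha
    by_cases haN : a ∈ zeroSet T lam <;> by_cases hbN : b ∈ zeroSet T lam
    · rw [contractMap_of_mem haN, contractMap_of_mem hbN, Sum.inl.injEq, Subtype.mk.injEq] at hfab
      exact (hab.ne hfab).elim
    · simp [contractMap_of_mem haN, contractMap_of_notMem hbN] at hfab
    · simp [contractMap_of_mem hbN, contractMap_of_notMem haN] at hfab
    · exact Eq.trans ha (hf a b haN hbN hab)
  · rw [contractMap_of_notMem huN, contractMap_of_notMem hvN, h]

/-- The scaled entries of an eigenvector are constant on every component. -/
theorem IsScaling.mul_eq_of_mem_verts (hθ : IsScaling T lam z θ) (hT : T.IsAcyclic)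
    (hzE : z ∈ (adjOp T).eigenspace lam) (hz : ∀ v ∉ zeroSet T lam, z v ≠ 0) {b : V → ℝ}
    (hb : b ∈ (adjOp T).eigenspace lam) {C : Comp T (zeroSet T lam)} {u v : V}
    (hu : u ∈ C.verts) (hv : v ∈ C.verts) : θ u * b u = θ v * b v := by
  refine eq_of_mem_verts (fun u => θ u * b u) (fun p q hp hq hpq => ?_) hu hv
  have h1 := mul_eq_mul_of_mem_eigenspace hT hzE hb hpq
  have h2 := hθ.mul_eq_of_adj p q hp hq hpq
  have h3 : (θ p * b p) * z q = (θ q * b q) * z q := by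
    linear_combination (-θ p) * h1 - b q * h2
  exact mul_right_cancel₀ (hz q hq) h3

theorem toSkeleton_eq_zero (b : V → ℝ) (a : ↥(skeletonVerts T lam))
    (ha : ∀ C, a ≠ compVertex C) : toSkeleton T lam θ b a = 0 := by
  obtain ⟨v, hv, hv', rfl⟩ | ⟨C, rfl⟩ := skeletonVerts_cases a
  · rfl
  · exact (ha C rfl).elim

theorem toSkeleton_compVertex (hθ : IsScaling T lam z θ) (hT : T.IsAcyclic)
    (hzE : z ∈ (adjOp T).eigenspace lam) (hz : ∀ v ∉ zeroSet T lam, z v ≠ 0) {b : V → ℝ}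
    (hb : b ∈ (adjOp T).eigenspace lam) {C : Comp T (zeroSet T lam)} {v : V} (hv : v ∈ C.verts) :
    toSkeleton T lam θ b (compVertex C) = θ v * b v := by
  refine hθ.mul_eq_of_mem_verts hT hzE hz hb (C := C) ?_ hv
  exact mem_verts_iff.2 ⟨(Quot.out C).2, Quot.out_eq C⟩

theorem ofSkeleton_of_mem {y : ↥(skeletonVerts T lam) → ℝ} {v : V} (hv : v ∈ zeroSet T lam) :
    ofSkeleton T lam θ y v = 0 := by
  simp [ofSkeleton, hv]

theorem ofSkeleton_of_mem_verts {y : ↥(skeletonVerts T lam) → ℝ} {C : Comp T (zeroSet T lam)}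
    {v : V} (hv : v ∈ C.verts) : ofSkeleton T lam θ y v = y (compVertex C) / θ v := by
  obtain ⟨hvN, rfl⟩ := mem_verts_iff.1 hv
  simp [ofSkeleton, hvN]

/-- A skeleton vector vanishing on the boundary vertices has zero neighbour sum at every contracted
component. -/
theorem adjOp_skeleton_compVertex (y : ↥(skeletonVerts T lam) → ℝ)
    (hy : ∀ a, (∀ C, a ≠ compVertex C) → y a = 0) (C : Comp T (zeroSet T lam)) :
    adjOp (skeleton T lam) y (compVertex C) = 0 := by
  classical
  have := Fintype.ofFinite ↥(skeletonVerts T lam)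
  rw [adjOp_apply]
  refine Finset.sum_eq_zero fun a _ => ?_
  split_ifs with h
  · refine hy a ?_
    rintro D rfl
    exact not_skeleton_adj_compVertex C D h
  · rfl

theorem toSkeleton_mem_ker (hθ : IsScaling T lam z θ) (hT : T.IsAcyclic)
    (hzE : z ∈ (adjOp T).eigenspace lam) (hz : ∀ v ∉ zeroSet T lam, z v ≠ 0) {b : V → ℝ}
    (hb : b ∈ (adjOp T).eigenspace lam) :
    toSkeleton T lam θ b ∈ LinearMap.ker (adjOp (skeleton T lam)) := by
  classical
  have := Fintype.ofFinite V
  rw [LinearMap.mem_ker]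
  ext a
  obtain ⟨v, hv, hv', rfl⟩ | ⟨C, rfl⟩ := skeletonVerts_cases a
  swap
  · exact adjOp_skeleton_compVertex _ (toSkeleton_eq_zero b) C
  rw [adjOp_skeleton_bdryVertex hT _ (toSkeleton_eq_zero b) hv hv']
  have h := congrFun (Module.End.mem_eigenspace_iff.1 hb) v
  rw [adjOp_apply, Pi.smul_apply, eq_zero_of_mem_zeroSet hb hv, smul_zero] at h
  -- This is the equation of `b` at `v` times `θ v`, which equals `θ u` for every neighbour `u` that
  -- contributes.
  refine (Eq.trans ?_ (congrArg (θ v * ·) h)).trans (mul_zero _)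
  rw [Finset.mul_sum]
  refine Finset.sum_congr rfl fun u _ => ?_
  split_ifs with hvu
  swap
  · rw [mul_zero]
  by_cases hu : u ∈ zeroSet T lam
  · rw [ofSkeleton_of_mem hu, eq_zero_of_mem_zeroSet hb hu, mul_zero]
  · rw [ofSkeleton_of_mem_verts (mem_verts_iff.2 ⟨hu, rfl⟩), div_one,
      toSkeleton_compVertex hθ hT hzE hz hb (mem_verts_iff.2 ⟨hu, rfl⟩),
      hθ.eq_of_adj v u hv hu hvu]

theorem mem_eigenspace_zero_iff {W : Type*} [Finite W] {G : SimpleGraph W} {y : W → ℝ} :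
    y ∈ (adjOp G).eigenspace 0 ↔ y ∈ LinearMap.ker (adjOp G) := by
  rw [Module.End.eigenspace_zero]

/-- Null vectors of the skeleton vanish at the vertices that are not contracted components. -/
theorem eq_zero_of_mem_ker (hT : T.IsAcyclic) {y : ↥(skeletonVerts T lam) → ℝ}
    (hy : y ∈ LinearMap.ker (adjOp (skeleton T lam))) (a : ↥(skeletonVerts T lam))
    (ha : ∀ C, a ≠ compVertex C) : y a = 0 := by
  obtain ⟨v, hv, hv', rfl⟩ | ⟨C, rfl⟩ := skeletonVerts_cases a
  swap
  · exact (ha C rfl).elim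
  obtain ⟨z, hzE, hz⟩ := exists_generic_mem_eigenspace T lam
  obtain ⟨θ, hθ⟩ := exists_isScaling hT hz
  obtain ⟨u, hu, hvu⟩ := exists_adj_notMem_zeroSet hv'
  have hmem : u ∈ Comp.verts ((T.induce (zeroSet T lam)ᶜ).connectedComponentMk ⟨u, hu⟩) :=
    mem_verts_iff.2 ⟨hu, rfl⟩
  -- Compare `y` with the image of `z`, which is zero at the boundary vertex but not at the adjacent
  -- contracted vertex; proportionality forces `y` to vanish at the former.
  have h := mul_eq_mul_of_mem_eigenspace (skeleton_isAcyclic hT)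
    (mem_eigenspace_zero_iff.2 hy)
    (mem_eigenspace_zero_iff.2 (toSkeleton_mem_ker hθ hT hzE hz hzE))
    ((skeleton_adj_bdryVertex_compVertex hv hv' _).2 ⟨u, hmem, hvu⟩)
  rw [toSkeleton_compVertex hθ hT hzE hz hzE hmem, toSkeleton_eq_zero z _ ha, zero_mul] at h
  exact (mul_eq_zero.1 h).resolve_right (mul_ne_zero (hθ.ne_zero u) (hz u hu))

theorem ofSkeleton_mem_eigenspace (hθ : IsScaling T lam z θ) (hT : T.IsAcyclic)
    (hzE : z ∈ (adjOp T).eigenspace lam) (hz : ∀ v ∉ zeroSet T lam, z v ≠ 0)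
    {y : ↥(skeletonVerts T lam) → ℝ} (hy : y ∈ LinearMap.ker (adjOp (skeleton T lam))) :
    ofSkeleton T lam θ y ∈ (adjOp T).eigenspace lam := by
  classical
  have := Fintype.ofFinite V
  rw [Module.End.mem_eigenspace_iff]
  ext v
  rw [adjOp_apply, Pi.smul_apply, smul_eq_mul]
  by_cases hv : v ∈ zeroSet T lam
  · rw [ofSkeleton_of_mem hv, mul_zero]
    by_cases hv' : v ∈ zeroBdry T lam
    · have h := congrFun (LinearMap.mem_ker.1 hy) (bdryVertex hv hv')
      rw [adjOp_skeleton_bdryVertex hT y (eq_zero_of_mem_ker hT hy), Pi.zero_apply] at h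
      refine (Eq.trans ?_ (congrArg ((θ v)⁻¹ * ·) h)).trans (mul_zero _)
      rw [Finset.mul_sum]
      refine Finset.sum_congr rfl fun u _ => ?_
      split_ifs with hvu
      swap
      · rw [mul_zero]
      by_cases hu : u ∈ zeroSet T lam
      · rw [ofSkeleton_of_mem hu, ofSkeleton_of_mem hu, mul_zero]
      · rw [ofSkeleton_of_mem_verts (mem_verts_iff.2 ⟨hu, rfl⟩),
          ofSkeleton_of_mem_verts (mem_verts_iff.2 ⟨hu, rfl⟩), div_one,
          hθ.eq_of_adj v u hv hu hvu, inv_mul_eq_div]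
    · refine Finset.sum_eq_zero fun u _ => ?_
      split_ifs with hvu
      · by_cases hu : u ∈ zeroSet T lam
        · exact ofSkeleton_of_mem hu
        · exact (hv' (mem_zeroBdry_of_adj hv hu hvu)).elim
      · rfl
  · have hvC : v ∈ Comp.verts ((T.induce (zeroSet T lam)ᶜ).connectedComponentMk ⟨v, hv⟩) :=
      mem_verts_iff.2 ⟨hv, rfl⟩
    have h := congrFun (Module.End.mem_eigenspace_iff.1 hzE) v
    rw [adjOp_apply, Pi.smul_apply, smul_eq_mul] at h
    have hθv := hθ.ne_zero v
    have hzv := hz v hv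
    -- On the component of `v` the vector is the constant `y / (θ * z)` times `z`, and both vanish
    -- on the zero set, so the equation is inherited from `z`.
    have hfac : ofSkeleton T lam θ y v = ofSkeleton T lam θ y v / z v * z v := by
      field_simp
    rw [hfac, mul_left_comm, ← h, Finset.mul_sum]
    refine Finset.sum_congr rfl fun u _ => ?_
    split_ifs with hvu
    swap
    · rw [mul_zero]
    by_cases hu : u ∈ zeroSet T lam
    · rw [ofSkeleton_of_mem hu, eq_zero_of_mem_zeroSet hzE hu, mul_zero]
    · have huC : u ∈ Comp.verts ((T.induce (zeroSet T lam)ᶜ).connectedComponentMk ⟨v, hv⟩) :=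
        mem_verts_iff.2 ⟨hu, ConnectedComponent.sound
          (Adj.reachable (by simpa using hvu.symm))⟩
      rw [ofSkeleton_of_mem_verts hvC, ofSkeleton_of_mem_verts huC]
      have h2 := hθ.mul_eq_of_adj v u hv hu hvu
      have hθu := hθ.ne_zero u
      field_simp
      linear_combination
        -y (compVertex ((T.induce (zeroSet T lam)ᶜ).connectedComponentMk ⟨v, hv⟩)) * h2

theorem samePattern_toSkeleton (hθ : IsScaling T lam z θ) (hT : T.IsAcyclic)
    (hzE : z ∈ (adjOp T).eigenspace lam) (hz : ∀ v ∉ zeroSet T lam, z v ≠ 0) {b : V → ℝ}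
    (hb : b ∈ (adjOp T).eigenspace lam) : SamePattern T lam b (toSkeleton T lam θ b) := by
  refine ⟨fun C v hv => ?_, fun v hv => eq_zero_of_mem_zeroSet hb hv, toSkeleton_eq_zero b⟩
  rw [toSkeleton_compVertex hθ hT hzE hz hb hv]
  simp [hθ.ne_zero v]

theorem samePattern_ofSkeleton (hθ : IsScaling T lam z θ) (hT : T.IsAcyclic)
    {y : ↥(skeletonVerts T lam) → ℝ} (hy : y ∈ LinearMap.ker (adjOp (skeleton T lam))) :
    SamePattern T lam (ofSkeleton T lam θ y) y := by
  refine ⟨fun C v hv => ?_, fun v hv => ofSkeleton_of_mem hv, eq_zero_of_mem_ker hT hy⟩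
  rw [ofSkeleton_of_mem_verts hv]
  simp [hθ.ne_zero v]

theorem exists_mem_verts (C : Comp T (zeroSet T lam)) : ∃ v, v ∈ C.verts :=
  ⟨(Quot.out C).1, mem_verts_iff.2 ⟨(Quot.out C).2, Quot.out_eq C⟩⟩

/-- Vectors with matching patterns are both zero or both non-zero. -/
theorem SamePattern.eq_zero_iff {x : V → ℝ} {y : ↥(skeletonVerts T lam) → ℝ}
    (h : SamePattern T lam x y) : x = 0 ↔ y = 0 := by
  constructor
  · rintro rfl
    ext a
    by_cases ha : ∃ C, a = compVertex C
    · obtain ⟨C, rfl⟩ := ha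
      obtain ⟨v, hv⟩ := exists_mem_verts C
      by_contra h0
      exact (h.1 C v hv).2 h0 rfl
    · push Not at ha
      exact h.2.2 a ha
  · rintro rfl
    ext v
    by_cases hv : v ∈ zeroSet T lam
    · exact h.2.1 v hv
    · by_contra h0
      exact (h.1 _ v (mem_verts_iff.2 ⟨hv, rfl⟩)).1 h0 rfl

theorem multiplicity_eq_nullity_skeleton (hT : T.IsAcyclic) :
    multiplicity T lam = nullity (skeleton T lam) := by
  obtain ⟨z, hzE, hz⟩ := exists_generic_mem_eigenspace T lam
  obtain ⟨θ, hθ⟩ := exists_isScaling hT hz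
  apply le_antisymm
  · refine LinearMap.finrank_le_finrank_of_injective
      (f := (toSkeleton T lam θ).restrict fun b hb => toSkeleton_mem_ker hθ hT hzE hz hb) ?_
    rw [injective_iff_map_eq_zero]
    rintro ⟨b, hb⟩ h0
    exact Subtype.ext ((samePattern_toSkeleton hθ hT hzE hz hb).eq_zero_iff.2
      (congrArg Subtype.val h0))
  · refine LinearMap.finrank_le_finrank_of_injective
      (f := (ofSkeleton T lam θ).restrict fun y hy => ofSkeleton_mem_eigenspace hθ hT hzE hz hy) ?_
    rw [injective_iff_map_eq_zero]
    rintro ⟨y, hy⟩ h0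
    exact Subtype.ext ((samePattern_ofSkeleton hθ hT hy).eq_zero_iff.1 (congrArg Subtype.val h0))

end Skeleton

end TreeSkeleton

/-! ### The five statements -/

theorem mainTheorem2 {V : Type*} [Finite V] (T : SimpleGraph V) (hT : T.IsTree) (lam : ℝ)
    (hlam : (TreeSkeleton.adjOp T).HasEigenvalue lam) :
    -- every eigenvector of the tree has a matching null vector of the skeleton
    (∀ b : V → ℝ, TreeSkeleton.IsEigvec T lam b →
      ∃ b' : ↥(TreeSkeleton.skeletonVerts T lam) → ℝ,
        TreeSkeleton.IsEigvec (TreeSkeleton.skeleton T lam) 0 b' ∧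
          TreeSkeleton.SamePattern T lam b b') ∧
    -- null vectors of the skeleton matching a straight set are linearly independent
    (∀ (r : ℕ) (b : Fin r → V → ℝ) (b' : Fin r → ↥(TreeSkeleton.skeletonVerts T lam) → ℝ),
      TreeSkeleton.IsStraight T lam b →
      (∀ j, TreeSkeleton.IsEigvec (TreeSkeleton.skeleton T lam) 0 (b' j)) →
      (∀ j, TreeSkeleton.SamePattern T lam (b j) (b' j)) → LinearIndependent ℝ b') ∧
    -- every non-zero null vector of the skeleton has a matching eigenvector of the tree
    (∀ b' : ↥(TreeSkeleton.skeletonVerts T lam) → ℝ,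
      TreeSkeleton.IsEigvec (TreeSkeleton.skeleton T lam) 0 b' →
      ∃ b : V → ℝ, TreeSkeleton.IsEigvec T lam b ∧ TreeSkeleton.SamePattern T lam b b') ∧
    -- eigenvectors of the tree matching a straight set of null vectors are linearly independent
    (∀ (r : ℕ) (b' : Fin r → ↥(TreeSkeleton.skeletonVerts T lam) → ℝ) (b : Fin r → V → ℝ),
      TreeSkeleton.IsStraight (TreeSkeleton.skeleton T lam) 0 b' →
      (∀ j, TreeSkeleton.IsEigvec T lam (b j)) →
      (∀ j, TreeSkeleton.SamePattern T lam (b j) (b' j)) → LinearIndependent ℝ b) ∧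
    -- the multiplicity equals the nullity of the skeleton
    TreeSkeleton.multiplicity T lam = TreeSkeleton.nullity (TreeSkeleton.skeleton T lam) := by
  have hA : T.IsAcyclic := hT.isAcyclic
  obtain ⟨z, hzE, hz⟩ := TreeSkeleton.exists_generic_mem_eigenspace T lam
  obtain ⟨θ, hθ⟩ := TreeSkeleton.exists_isScaling hA hz
  refine ⟨fun b hb => ?_, fun r b b' hb _ hp => ?_, fun b' hb' => ?_, fun r b' b hb' _ hp => ?_,
    TreeSkeleton.multiplicity_eq_nullity_skeleton hA⟩
  · have hp := TreeSkeleton.samePattern_toSkeleton hθ hA hzE hz hb.1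
    exact ⟨_, ⟨TreeSkeleton.mem_eigenspace_zero_iff.2
      (TreeSkeleton.toSkeleton_mem_ker hθ hA hzE hz hb.1), fun h => hb.2 (hp.eq_zero_iff.2 h)⟩, hp⟩
  · obtain ⟨-, C, hC⟩ := hb
    refine TreeSkeleton.linearIndependent_of_triangular b'
      (fun j => TreeSkeleton.compVertex (C j)) (fun j => ?_) (fun j i hji => ?_)
    · obtain ⟨⟨v, hv, hne⟩, -⟩ := hC j
      exact ((hp j).1 (C j) v hv).1 hne
    · obtain ⟨v, hv⟩ := TreeSkeleton.exists_mem_verts (C i)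
      by_contra h0
      exact ((hp j).1 (C i) v hv).2 h0 ((hC j).2 i hji v hv)
  · have hk := TreeSkeleton.mem_eigenspace_zero_iff.1 hb'.1
    have hp := TreeSkeleton.samePattern_ofSkeleton hθ hA hk
    exact ⟨_, ⟨TreeSkeleton.ofSkeleton_mem_eigenspace hθ hA hzE hz hk,
      fun h => hb'.2 (hp.eq_zero_iff.1 h)⟩, hp⟩
  · obtain ⟨-, D, hD⟩ := hb'
    have hex : ∀ j, ∃ v, b j v ≠ 0 ∧ ∀ i, i < j → b i v = 0 := by
      intro j
      obtain ⟨⟨a, ha, hne⟩, -⟩ := hD j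
      -- A vertex where `b' j` is non-zero must be a contracted one, so any tree vertex of `C`
      -- serves as the pivot coordinate for `b j`.
      obtain ⟨C, rfl⟩ : ∃ C, a = TreeSkeleton.compVertex C := by
        by_contra h
        push Not at h
        exact hne ((hp j).2.2 a h)
      obtain ⟨v, hv⟩ := TreeSkeleton.exists_mem_verts C
      refine ⟨v, ((hp j).1 C v hv).2 hne, fun i hij => ?_⟩
      by_contra h0
      exact ((hp i).1 C v hv).1 h0 ((hD i).2 j hij _ ha)
    choose w hw hw' using hex
    exact TreeSkeleton.linearIndependent_of_triangular b w hw fun j i hji => hw' i j hji
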